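/- Let $q$ be a prime power, let $h\ge 1$ and $\eta\geq 1$ be integers with $2\eta\le q-1$, and put $\ell=2h$ and $t=q^{2\ell}-1$. Let $\alpha$ be a primitive element of $\mathbf F_{q^{2\ell}}$. For an integer $\delta\ge 2$ let $C_{(q^2,t,\delta,1)}\subseteq \mathbf F_{q^2}^t$ be the (primitive, narrow-sense) BCH code of length $t$ and designed distance $\delta$, that is, the cyclic code over $\mathbf F_{q^2}$ of length $t$ with generator polynomial $\mathrm{lcm}(m_{\alpha}(x),m_{\alpha^2}(x),\dots,m_{\alpha^{\delta-1}}(x))$, where $m_{\gamma}(x)$ is the minimal polynomial of $\gamma$ over $\mathbf F_{q^2}$. For linear codes $C_0,C_1\subseteq\mathbf F_{q^2}^t$ let $$\mathrm{SR}(C_0,C_1)=\{(c_{0,j}\,x+c_{1,j}\,x^{q})_{1\le j\le t} : (c_{i,1},\dots,c_{i,t})\in C_i,\ i=0,1\},$$ where each $a_0x+a_1x^q$ is regarded as an $\mathbf F_q$-linear map $\mathbf F_{q^2}\to\mathbf F_{q^2}$ and, after a basis of $\mathbf F_{q^2}$ over $\mathbf F_q$ is fixed, as a $2\times 2$ matrix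 over $\mathbf F_q$. The sum-rank distance of $(x_j)_j$ and $(y_j)_j$ is $\sum_{j=1}^t\mathrm{rank}(x_j-y_j)$. Then $S=\mathrm{SR}\bigl(C_{(q^2,t,\eta(q^{2h}+1),1)},\,C_{(q^2,t,2\eta(q^{2h}+1),1)}\bigr)$ is a linear cyclic sum-rank code over $\mathbf F_q$ (that is, $(x_1,\dots,x_t)\in S$ implies $(x_t,x_1,\dots,x_{t-1})\in S$) with block length $t$ and matrix size $2\times2$. Its dimension over $\mathbf F_q$ is $$2\Bigl[2t-\tfrac{\ell}{2}\bigl(6\eta(q^{2h}-q^{2(h-1)})-(\eta-1)^2-(2\eta-1)^2\bigr)\Bigr],$$ and its minimum sum-rank distance is exactly $2\eta(q^{2h}+1)$. -/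

import Mathlib

open Polynomial

namespace SumRankCodes

noncomputable section

/-! ### Cyclic codes and BCH codes in the Hamming metric -/

/-- The identification of a vector `(c_0, …, c_{t-1})` with the residue class of the polynomial
`c_0 + c_1 X + ⋯ + c_{t-1} X^{t-1}` in `F[X]/(X^t - 1)`. -/
def toQuotient (F : Type*) [Field F] (t : ℕ) :
    (Fin t → F) →ₗ[F] F[X] ⧸ Ideal.span {(X ^ t - 1 : F[X])} where
  toFun c := Ideal.Quotient.mk _ (∑ i : Fin t, C (c i) * X ^ (i : ℕ))
  map_add' c d := by
    rw [← map_add, ← Finset.sum_add_distrib]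
    simp only [Pi.add_apply, C_add, add_mul]
  map_smul' a c := by
    have h : (∑ i : Fin t, C ((a • c) i) * X ^ (i : ℕ)) =
        a • ∑ i : Fin t, C (c i) * X ^ (i : ℕ) := by
      rw [Finset.smul_sum]
      refine Finset.sum_congr rfl fun i _ => ?_
      rw [Pi.smul_apply, smul_eq_mul, C_mul, mul_assoc, smul_eq_C_mul]
    rw [h]
    rfl

/-- The cyclic code of length `t` over `F` with generator polynomial `g`: the vectors whose
residue class lies in the ideal of `F[X]/(X^t - 1)` generated by the class of `g`. -/
def cyclicCode {F : Type*} [Field F] (t : ℕ) (g : F[X]) : Submodule F (Fin t → F) :=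
  ((Ideal.span {Ideal.Quotient.mk (Ideal.span {(X ^ t - 1 : F[X])}) g}).restrictScalars F).comap
    (toQuotient F t)

/-- Monic greatest common divisors and least common multiples of polynomials over a field. -/
instance polynomialGCD (F : Type*) [Field F] : NormalizedGCDMonoid F[X] :=
  letI : DecidableEq F := Classical.decEq F
  UniqueFactorizationMonoid.toNormalizedGCDMonoid F[X]

/-- The generator polynomial `lcm (m_{β^b}, m_{β^{b+1}}, …, m_{β^{b+δ-2}})` of the BCH code of
length `t`, with designed distance `δ` and offset `b`, over the finite field `F`.  Here `E` is a
finite extension field of `F`, `α` is (meant to be) a primitive element of `E`,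
`β = α ^ ((|E| - 1) / t)`, and `m_γ` is the minimal polynomial of `γ` over `F`. -/
def bchGenerator (F : Type*) {E : Type*} [Field F] [Field E] [Algebra F E]
    (α : Eˣ) (t δ b : ℕ) : F[X] :=
  (Finset.range (δ - 1)).lcm fun i =>
    minpoly F (((α : E) ^ ((Nat.card E - 1) / t)) ^ (b + i))

/-- The BCH code `C_(|F|, t, δ, b)`. -/
def bchCode (F : Type*) {E : Type*} [Field F] [Field E] [Algebra F E]
    (α : Eˣ) (t δ b : ℕ) : Submodule F (Fin t → F) :=
  cyclicCode t (bchGenerator F α t δ b)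

/-! ### Sum-rank codes -/

/-- The sum-rank weight of a tuple of matrices. -/
def sumRankWeight {K : Type*} [Field K] {t n m : ℕ} (x : Fin t → Matrix (Fin n) (Fin m) K) : ℕ :=
  ∑ i, (x i).rank

/-- The sum-rank distance. -/
def sumRankDist {K : Type*} [Field K] {t n m : ℕ} (x y : Fin t → Matrix (Fin n) (Fin m) K) : ℕ :=
  sumRankWeight (x - y)

/-- `d` is the minimum sum-rank distance of the code `S`: the minimum of the distances between
two distinct codewords (so in particular `S` has two distinct codewords). -/
def IsMinSumRankDist {K : Type*} [Field K] {t n m : ℕ}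
    (S : Set (Fin t → Matrix (Fin n) (Fin m) K)) (d : ℕ) : Prop :=
  IsLeast {e : ℕ | ∃ x ∈ S, ∃ y ∈ S, x ≠ y ∧ sumRankDist x y = e} d

/-- A code is a cyclic sum-rank code if `(x_1, …, x_t) ∈ S` implies
`(x_t, x_1, …, x_{t-1}) ∈ S`. -/
def IsCyclicSumRank {K : Type*} [Field K] {t n m : ℕ}
    (S : Set (Fin t → Matrix (Fin n) (Fin m) K)) : Prop :=
  ∀ x ∈ S, (fun i => x ((finRotate t).symm i)) ∈ S

/-- The `K`-linear map `L → L` of the `q`-polynomial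
`a_0 x + a_1 x^q + ⋯ + a_{m-1} x^{q^{m-1}}`, where `q = |K|`. -/
def qPolyMap (K : Type*) {L : Type*} [Field K] [Fintype K] [Field L] [Algebra K L] {m : ℕ}
    (a : Fin m → L) : L →ₗ[K] L where
  toFun x := ∑ i : Fin m, a i * x ^ (Fintype.card K ^ (i : ℕ))
  map_add' x y := by
    rw [← Finset.sum_add_distrib]
    refine Finset.sum_congr rfl fun i _ => ?_
    have h := map_add ((FiniteField.frobeniusAlgHom K L) ^ (i : ℕ)) x y
    simp only [AlgHom.coe_pow, FiniteField.coe_frobeniusAlgHom, pow_iterate] at h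
    rw [h, mul_add]
  map_smul' c x := by
    rw [RingHom.id_apply, Finset.smul_sum]
    refine Finset.sum_congr rfl fun i _ => ?_
    have h := map_smul ((FiniteField.frobeniusAlgHom K L) ^ (i : ℕ)) c x
    simp only [AlgHom.coe_pow, FiniteField.coe_frobeniusAlgHom, pow_iterate] at h
    rw [h, mul_smul_comm]

/-- The word `SR(c_0, …, c_{m-1})`: its `j`-th block is the `m × m` matrix over `K`, in the basis
`B` of `L` over `K`, of the `q`-polynomial `∑ i, c_{i,j} x^{q^i}`. -/
def srWord {K L : Type*} [Field K] [Fintype K] [Field L] [Algebra K L] {m t : ℕ}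
    (B : Module.Basis (Fin m) K L) (c : Fin m → Fin t → L) : Fin t → Matrix (Fin m) (Fin m) K :=
  fun j => LinearMap.toMatrix B B (qPolyMap K fun i => c i j)

/-- The sum-rank code `SR(C_0, …, C_{m-1})`. -/
def srCode {K L : Type*} [Field K] [Fintype K] [Field L] [Algebra K L] {m t : ℕ}
    (B : Module.Basis (Fin m) K L) (D : Fin m → Submodule L (Fin t → L)) :
    Submodule K (Fin t → Matrix (Fin m) (Fin m) K) where
  carrier := {x | ∃ c : Fin m → Fin t → L, (∀ i, c i ∈ D i) ∧ srWord B c = x}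
  zero_mem' := by
    refine ⟨0, fun i => (D i).zero_mem, ?_⟩
    funext j
    have h : qPolyMap K (fun i : Fin m => (0 : Fin m → Fin t → L) i j) = 0 := by
      ext x
      simp [qPolyMap]
    change LinearMap.toMatrix B B _ = 0
    rw [h, map_zero]
  add_mem' := by
    rintro _ _ ⟨c, hc, rfl⟩ ⟨d, hd, rfl⟩
    refine ⟨c + d, fun i => (D i).add_mem (hc i) (hd i), ?_⟩
    funext j
    have h : qPolyMap K (fun i => (c + d) i j) =
        qPolyMap K (fun i => c i j) + qPolyMap K (fun i => d i j) := by
      ext x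
      simp [qPolyMap, add_mul, Finset.sum_add_distrib]
    change LinearMap.toMatrix B B _ = LinearMap.toMatrix B B _ + LinearMap.toMatrix B B _
    rw [h, map_add]
  smul_mem' := by
    rintro a _ ⟨c, hc, rfl⟩
    refine ⟨a • c, fun i => ?_, ?_⟩
    · have := (D i).smul_mem (algebraMap K L a) (hc i)
      rwa [algebraMap_smul] at this
    · funext j
      have h : qPolyMap K (fun i => (a • c) i j) = a • qPolyMap K (fun i => c i j) := by
        ext x
        simp [qPolyMap, Finset.smul_sum]
      change LinearMap.toMatrix B B _ = a • LinearMap.toMatrix B B _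
      rw [h, map_smul]

end

end SumRankCodes

/-! Put `Q = q ^ 2`; both codes have designed distance `a * (Q ^ h + 1)` with `a < Q`, namely `a =
η` and `a = 2 * η`.

Dimension: a nonzero `a_0 x + a_1 x^q` has degree at most `q < q ^ 2`, so it is not the zero map;
encoding is injective and the dimension is twice the sum of the two BCH dimensions
(`finrank_srCode`). The degree of a BCH generator counts the exponents in the `Q`-cyclotomic cosets
of `1, …, δ - 1`. In base `Q ^ h`, multiplication by `Q ^ h` swaps the digits of `u * Q ^ h + v`, so
each such coset has exactly one leader with `u ≤ v`, `u < a`, `¬ Q ∣ v`; the coset has size `2 * h`,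
or `h` when `u = v` (`exists_leader`, `leader_mul_pow_modEq`, `sum_leaderPairs`).

Distance: let `d = η * (Q ^ h + 1)`. If `c_1 ≠ 0`, each nonzero entry of `c_1` gives rank at least
1, and the BCH bound gives `2 * d`. If `c_1 = 0`, each nonzero entry of `c_0` gives rank 2, and the
BCH bound gives `2 * d` again. Equality needs a word of weight `d` in the first code; it is built
constant on fibres of the norm (`exists_mem_bchCode_card_support_le`). -/

namespace SumRankCodes

/-! ### Cyclic codes and their dimension -/

section CyclicCode

variable {F : Type*} [Field F]

theorem mem_cyclicCode_iff {t : ℕ} {g : F[X]} (hg : g ∣ X ^ t - 1) (c : Fin t → F) :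
    c ∈ cyclicCode t g ↔ g ∣ ∑ i : Fin t, C (c i) * X ^ (i : ℕ) := by
  change Ideal.Quotient.mk (Ideal.span {(X ^ t - 1 : F[X])}) (∑ i : Fin t, C (c i) * X ^ (i : ℕ)) ∈
    Ideal.span {Ideal.Quotient.mk (Ideal.span {(X ^ t - 1 : F[X])}) g} ↔ _
  rw [Ideal.mem_span_singleton]
  refine ⟨?_, map_dvd _⟩
  rintro ⟨z, hz⟩
  obtain ⟨f, rfl⟩ := Ideal.Quotient.mk_surjective z
  rw [← map_mul, Ideal.Quotient.mk_eq_mk_iff_sub_mem, Ideal.mem_span_singleton] at hz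
  have := dvd_add (hg.trans hz) (dvd_mul_right g f)
  rwa [sub_add_cancel] at this

/-- The linear map sending a word to its polynomial. -/
noncomputable def toPolynomial (F : Type*) [Field F] (t : ℕ) : (Fin t → F) →ₗ[F] F[X] :=
  ∑ i : Fin t, (monomial (i : ℕ)).comp (LinearMap.proj i)

theorem toPolynomial_apply (t : ℕ) (c : Fin t → F) :
    toPolynomial F t c = ∑ i : Fin t, C (c i) * X ^ (i : ℕ) := by
  simp [toPolynomial, LinearMap.sum_apply, C_mul_X_pow_eq_monomial]

theorem exists_toPolynomial_eq {t : ℕ} {p : F[X]} (hp : p.degree < t) :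
    ∃ c : Fin t → F, toPolynomial F t c = p := by
  refine ⟨fun i => p.coeff i, ?_⟩
  rw [toPolynomial_apply, Fin.sum_univ_eq_sum_range (fun i => C (p.coeff i) * X ^ i) t]
  simp_rw [C_mul_X_pow_eq_monomial]
  rcases eq_or_ne p 0 with rfl | h0
  · simp
  · exact (p.as_sum_range' t ((natDegree_lt_iff_degree_lt h0).2 hp)).symm

/-- The code is the kernel of the map from words to `F[X] / (g)`, which is onto because remainders
modulo `g` have degree below `t`. -/
theorem finrank_cyclicCode_add_natDegree {t : ℕ} (ht : 0 < t) {g : F[X]} (hg : g ∣ X ^ t - 1) :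
    Module.finrank F (cyclicCode t g) + g.natDegree = t := by
  have h1 : (X ^ t - 1 : F[X]) ≠ 0 := X_pow_sub_C_ne_zero ht 1
  have hg0 : g ≠ 0 := ne_zero_of_dvd_ne_zero h1 hg
  have hdeg : g.natDegree ≤ t := by
    have := natDegree_le_of_dvd hg h1
    rwa [show (X ^ t - 1 : F[X]) = X ^ t - C 1 by simp, natDegree_X_pow_sub_C] at this
  let f : (Fin t → F) →ₗ[F] (F[X] ⧸ Ideal.span {g}) :=
    (Ideal.Quotient.mkₐ F (Ideal.span {g})).toLinearMap.comp (toPolynomial F t)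
  have hker : LinearMap.ker f = cyclicCode t g := by
    ext c
    rw [mem_cyclicCode_iff hg, LinearMap.mem_ker, ← toPolynomial_apply]
    change Ideal.Quotient.mk (Ideal.span {g}) _ = 0 ↔ _
    rw [Ideal.Quotient.eq_zero_iff_mem, Ideal.mem_span_singleton]
  have hsurj : LinearMap.range f = ⊤ := by
    rw [LinearMap.range_eq_top]
    intro z
    obtain ⟨p, rfl⟩ := Ideal.Quotient.mk_surjective z
    have hlt : (p % g).degree < t :=
      (EuclideanDomain.mod_lt p hg0).trans_le (degree_le_of_natDegree_le hdeg)
    obtain ⟨c, hc⟩ := exists_toPolynomial_eq hlt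
    refine ⟨c, ?_⟩
    change Ideal.Quotient.mk (Ideal.span {g}) (toPolynomial F t c) = _
    rw [hc, Ideal.Quotient.mk_eq_mk_iff_sub_mem, Ideal.mem_span_singleton]
    exact (EuclideanDomain.mod_eq_sub_mul_div p g) ▸ ⟨-(p / g), by ring⟩
  have := LinearMap.finrank_range_add_finrank_ker f
  rw [hker, hsurj, finrank_top, finrank_quotient_span_eq_natDegree, Module.finrank_fin_fun] at this
  omega

end CyclicCode

/-! ### BCH codes: parity checks, rotation, designed distance -/

section BCH

variable {F E : Type*} [Field F] [Field E] [Algebra F E]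

theorem units_pow_card_sub_one [Finite E] (α : Eˣ) : (α : E) ^ (Nat.card E - 1) = 1 := by
  have := Fintype.ofFinite E
  rw [Nat.card_eq_fintype_card]
  exact FiniteField.pow_card_sub_one_eq_one _ α.ne_zero

theorem aeval_lcm_minpoly_eq_zero_iff {ι : Type*} [FiniteDimensional F E] (s : Finset ι)
    (γ : ι → E) (x : E) :
    aeval x (s.lcm fun i => minpoly F (γ i)) = 0 ↔ ∃ i ∈ s, aeval x (minpoly F (γ i)) = 0 := by
  constructor
  · intro h
    have hd : (s.lcm fun i => minpoly F (γ i)) ∣ ∏ i ∈ s, minpoly F (γ i) :=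
      Finset.lcm_dvd fun i hi => Finset.dvd_prod_of_mem _ hi
    have := aeval_eq_zero_of_dvd_aeval_eq_zero hd h
    rwa [map_prod, Finset.prod_eq_zero_iff] at this
  · rintro ⟨i, hi, h⟩
    exact aeval_eq_zero_of_dvd_aeval_eq_zero (Finset.dvd_lcm hi) h

theorem injective_pow_primitive {t : ℕ} (α : Eˣ) (hα : ∀ x : Eˣ, x ∈ Subgroup.zpowers α)
    (ht : t = Nat.card E - 1) : Function.Injective fun j : Fin t => (α : E) ^ (j : ℕ) := by
  intro i j hij
  have ho : orderOf α = t := by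
    rw [orderOf_eq_card_of_forall_mem_zpowers hα, Nat.card_units, ht]
  have h : α ^ (i : ℕ) = α ^ (j : ℕ) := Units.ext (by simpa using hij)
  exact Fin.ext (pow_injOn_Iio_orderOf (by simp [ho]) (by simp [ho]) h)

variable [Finite E]

theorem card_sub_one_pos : 0 < Nat.card E - 1 := by
  have := Finite.one_lt_card (α := E)
  omega

theorem bchGenerator_eq {t : ℕ} (α : Eˣ) (ht : t = Nat.card E - 1) (δ : ℕ) :
    bchGenerator F α t δ 1 =
      (Finset.range (δ - 1)).lcm fun i => minpoly F ((α : E) ^ (1 + i)) := by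
  subst ht
  simp [bchGenerator, Nat.div_self (card_sub_one_pos (E := E))]

theorem bchGenerator_dvd {t : ℕ} (α : Eˣ) (ht : t = Nat.card E - 1) (δ : ℕ) :
    bchGenerator F α t δ 1 ∣ X ^ t - 1 := by
  rw [bchGenerator_eq α ht]
  refine Finset.lcm_dvd fun i _ => minpoly.dvd _ _ ?_
  rw [map_sub, map_pow, aeval_X, map_one, ← pow_mul, mul_comm, pow_mul, ht,
    units_pow_card_sub_one, one_pow, sub_self]

theorem mem_bchCode_iff {t : ℕ} (α : Eˣ) (ht : t = Nat.card E - 1) (δ : ℕ) (c : Fin t → F) :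
    c ∈ bchCode F α t δ 1 ↔
      ∀ i, 1 ≤ i → i < δ → ∑ j, algebraMap F E (c j) * ((α : E) ^ (j : ℕ)) ^ i = 0 := by
  have key (i : ℕ) : minpoly F ((α : E) ^ i) ∣ ∑ j : Fin t, C (c j) * X ^ (j : ℕ) ↔
      ∑ j, algebraMap F E (c j) * ((α : E) ^ (j : ℕ)) ^ i = 0 := by
    rw [minpoly.dvd_iff, map_sum]
    simp only [map_mul, aeval_C, map_pow, aeval_X]
    simp only [← pow_mul, mul_comm i]
  rw [bchCode, mem_cyclicCode_iff (bchGenerator_dvd α ht δ), bchGenerator_eq α ht,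
    Finset.lcm_dvd_iff]
  constructor
  · intro h i h1 h2
    obtain ⟨k, rfl⟩ := Nat.exists_eq_add_of_le h1
    exact (key _).1 (h k (Finset.mem_range.2 (by omega)))
  · intro h k hk
    rw [Finset.mem_range] at hk
    exact (key _).2 (h _ (by omega) (by omega))

theorem pow_finRotate {t : ℕ} (α : Eˣ) (ht : t = Nat.card E - 1) (j : Fin t) :
    (α : E) ^ (finRotate t j : ℕ) = α ^ (j : ℕ) * α := by
  obtain _ | n := t
  · exact j.elim0
  rcases eq_or_ne j (Fin.last n) with rfl | hj
  · have h := units_pow_card_sub_one α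
    rw [← ht, pow_succ] at h
    rw [finRotate_last, Fin.val_last, h]
    simp
  · rw [coe_finRotate_of_ne_last hj, pow_succ]

theorem bchCode_rotate {t : ℕ} (α : Eˣ) (ht : t = Nat.card E - 1) (δ : ℕ) {c : Fin t → F}
    (hc : c ∈ bchCode F α t δ 1) : (fun i => c ((finRotate t).symm i)) ∈ bchCode F α t δ 1 := by
  rw [mem_bchCode_iff α ht] at hc ⊢
  intro i h1 h2
  rw [← Equiv.sum_comp (finRotate t)]
  simp only [Equiv.symm_apply_apply, pow_finRotate α ht, mul_pow, ← mul_assoc]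
  rw [← Finset.sum_mul, hc i h1 h2, zero_mul]

/-- The BCH bound. -/
theorem le_card_support_of_mem_bchCode [DecidableEq F] {t : ℕ} (α : Eˣ) (hα : ∀ x : Eˣ, x ∈ Subgroup.zpowers α)
    (ht : t = Nat.card E - 1) (δ : ℕ) {c : Fin t → F} (hc : c ∈ bchCode F α t δ 1) (h0 : c ≠ 0) :
    δ ≤ (Finset.univ.filter fun j => c j ≠ 0).card := by
  rw [mem_bchCode_iff α ht] at hc
  set T := Finset.univ.filter fun j => c j ≠ 0 with hT
  by_contra! hlt
  obtain ⟨k, hk⟩ := Function.ne_iff.1 h0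
  have hkT : k ∈ T := by simpa [hT] using hk
  -- `P` vanishes at every support point except that of `k`. The factor `X` removes the constant
  -- term, since there is no parity check at exponent `0`, and the degree is still only `T.card <
  -- δ`.
  let P : E[X] := X * ∏ j ∈ T.erase k, (X - C ((α : E) ^ (j : ℕ)))
  have hdeg : P.natDegree < δ := by
    refine lt_of_le_of_lt ?_ hlt
    refine natDegree_mul_le.trans ?_
    rw [natDegree_X, natDegree_prod_of_monic _ _ fun j _ => monic_X_sub_C _]
    simp only [natDegree_X_sub_C, Finset.sum_const, smul_eq_mul, mul_one]
    rw [add_comm, Finset.card_erase_add_one hkT]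
  have hsum : ∑ j, algebraMap F E (c j) * P.eval ((α : E) ^ (j : ℕ)) = 0 := by
    simp_rw [eval_eq_sum_range, Finset.mul_sum]
    rw [Finset.sum_comm]
    refine Finset.sum_eq_zero fun i hi => ?_
    rcases Nat.eq_zero_or_pos i with rfl | hpos
    · simp [P]
    · have := hc i hpos (by have := Finset.mem_range.1 hi; omega)
      simp_rw [mul_left_comm _ (P.coeff i)]
      rw [← Finset.mul_sum, this, mul_zero]
  rw [Finset.sum_eq_single k] at hsum
  · rcases mul_eq_zero.1 hsum with h | h
    · exact hk ((map_eq_zero _).1 h)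
    · simp only [P, eval_mul, eval_X, eval_prod, eval_sub, eval_C, mul_eq_zero,
        Finset.prod_eq_zero_iff] at h
      rcases h with h | ⟨j, hj, h⟩
      · exact pow_ne_zero _ α.ne_zero h
      · exact (Finset.ne_of_mem_erase hj)
          (injective_pow_primitive α hα ht (sub_eq_zero.1 h)).symm
  · intro j _ hjk
    by_cases hj : c j = 0
    · simp [hj]
    · have : P.eval ((α : E) ^ (j : ℕ)) = 0 := by
        simp only [P, eval_mul, eval_prod]
        rw [Finset.prod_eq_zero (i := j) (by simp [hT, hj, hjk]) (by simp), mul_zero]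
      rw [this, mul_zero]
  · simp

end BCH

/-! ### Cyclotomic cosets modulo `Q ^ (2 * h) - 1` -/

section Cosets

/-- The pairs `(u, v)` such that the numbers `u * Q ^ h + v` are the coset leaders below
`a * (Q ^ h + 1)` of the `Q`-cyclotomic cosets modulo `Q ^ (2 * h) - 1`. -/
def leaderPairs (Q h a : ℕ) : Finset (Σ _ : ℕ, ℕ) :=
  (Finset.range a).sigma fun u => (Finset.Ico u (Q ^ h)).filter fun v => ¬ Q ∣ v

theorem mem_leaderPairs {Q h a : ℕ} {p : Σ _ : ℕ, ℕ} :
    p ∈ leaderPairs Q h a ↔ p.1 < a ∧ (p.1 ≤ p.2 ∧ p.2 < Q ^ h) ∧ ¬ Q ∣ p.2 := by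
  simp [leaderPairs]

variable {Q h : ℕ}

theorem pow_two_mul_modEq_one (hQ : 0 < Q) : Q ^ (2 * h) ≡ 1 [MOD Q ^ (2 * h) - 1] := by
  have : Q ^ (2 * h) = 1 + (Q ^ (2 * h) - 1) := by
    have := Nat.pow_pos (n := 2 * h) hQ
    omega
  conv_lhs => rw [this]
  simp [Nat.ModEq]

theorem leader_lt {u v : ℕ} (hu : u + 1 < Q) (hv : v < Q ^ h) : u * Q ^ h + v < (Q - 1) * Q ^ h := by
  calc u * Q ^ h + v < (u + 1) * Q ^ h := by rw [add_mul, one_mul]; omega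
    _ ≤ (Q - 1) * Q ^ h := Nat.mul_le_mul_right _ (by omega)

theorem sub_one_mul_pow_le {n m : ℕ} (hQ : 0 < Q) (hn : n + 1 ≤ m) :
    (Q - 1) * Q ^ n ≤ Q ^ m - 1 := by
  have h1 : Q ^ (n + 1) ≤ Q ^ m := Nat.pow_le_pow_right hQ hn
  have h2 := Nat.pow_pos (n := n) hQ
  rw [Nat.sub_mul, one_mul]
  rw [pow_succ, mul_comm] at h1
  omega

/-- Both sides are below the modulus, so the congruence would be an equality between a multiple of
`Q` and a non-multiple. -/
theorem not_leader_mul_pow_modEq {u v u' v' j : ℕ} (hu : u + 1 < Q) (hv : v < Q ^ h)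
    (hu' : u' + 1 < Q) (hv' : v' < Q ^ h) (hQv' : ¬ Q ∣ v') (hj : 0 < j) (hjh : j < h) :
    ¬ (u * Q ^ h + v) * Q ^ j ≡ u' * Q ^ h + v' [MOD Q ^ (2 * h) - 1] := by
  intro hmod
  have h1 : (u * Q ^ h + v) * Q ^ j < Q ^ (2 * h) - 1 := by
    calc (u * Q ^ h + v) * Q ^ j < (Q - 1) * Q ^ h * Q ^ j :=
          Nat.mul_lt_mul_of_pos_right (leader_lt hu hv) (Nat.pow_pos (by omega))
      _ = (Q - 1) * Q ^ (h + j) := by rw [pow_add, mul_assoc]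
      _ ≤ _ := sub_one_mul_pow_le (by omega) (by omega)
  have h2 : u' * Q ^ h + v' < Q ^ (2 * h) - 1 :=
    (leader_lt hu' hv').trans_le (sub_one_mul_pow_le (by omega) (by omega))
  have heq := hmod.eq_of_lt_of_lt h1 h2
  have hd : Q ∣ u' * Q ^ h + v' := heq ▸ (dvd_pow_self Q hj.ne').mul_left _
  exact hQv' ((Nat.dvd_add_right ((dvd_pow_self Q (by omega)).mul_left _)).1 hd)

theorem leader_mul_pow_modEq_swap (hQ : 0 < Q) (u v : ℕ) :
    (u * Q ^ h + v) * Q ^ h ≡ v * Q ^ h + u [MOD Q ^ (2 * h) - 1] := by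
  have h1 : (u * Q ^ h + v) * Q ^ h = v * Q ^ h + u * Q ^ (2 * h) := by ring
  rw [h1]
  simpa using ((pow_two_mul_modEq_one (h := h) hQ).mul_left u).add_left (v * Q ^ h)

theorem eq_of_mul_pow_add_eq {u v u' v' : ℕ} (hv : v < Q ^ h) (hv' : v' < Q ^ h)
    (heq : u * Q ^ h + v = u' * Q ^ h + v') : u = u' ∧ v = v' := by
  have h0 : 0 < Q ^ h := by omega
  have h1 := congrArg (· / Q ^ h) heq
  have h2 := congrArg (· % Q ^ h) heq
  simp only [mul_comm _ (Q ^ h), Nat.mul_add_div h0, Nat.mul_add_mod, Nat.div_eq_of_lt hv,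
    Nat.div_eq_of_lt hv', Nat.mod_eq_of_lt hv, Nat.mod_eq_of_lt hv', add_zero] at h1 h2
  exact ⟨h1, h2⟩

/-- Distinct leaders lie in distinct cosets, and only diagonal ones have a nontrivial stabiliser.
Shifts beyond `h` are inverted to shifts below `h`; the shift by `h` swaps the digits, and `u ≤ v`,
`u' ≤ v'` then force all four to agree. -/
theorem leader_mul_pow_modEq (hh : 1 ≤ h) {u v u' v' j : ℕ} (hu : u + 1 < Q) (huv : u ≤ v)
    (hv : v < Q ^ h) (hQv : ¬ Q ∣ v) (hu' : u' + 1 < Q) (huv' : u' ≤ v') (hv' : v' < Q ^ h)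
    (hQv' : ¬ Q ∣ v') (hj : j < 2 * h)
    (hmod : (u * Q ^ h + v) * Q ^ j ≡ u' * Q ^ h + v' [MOD Q ^ (2 * h) - 1]) :
    (u = u' ∧ v = v') ∧ (j = 0 ∨ j = h ∧ u = v) := by
  have hQ : 0 < Q := by omega
  have hlt {a b : ℕ} (ha : a + 1 < Q) (hb : b < Q ^ h) : a * Q ^ h + b < Q ^ (2 * h) - 1 :=
    (leader_lt ha hb).trans_le (sub_one_mul_pow_le hQ (by omega))
  have hQr : Q ≤ Q ^ h := Nat.le_self_pow (by omega) Q
  rcases Nat.eq_zero_or_pos j with rfl | hpos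
  · rw [pow_zero, mul_one] at hmod
    exact ⟨eq_of_mul_pow_add_eq hv hv' (hmod.eq_of_lt_of_lt (hlt hu hv) (hlt hu' hv')), Or.inl rfl⟩
  rcases lt_trichotomy j h with hjh | rfl | hjh
  · exact absurd hmod (not_leader_mul_pow_modEq hu hv hu' hv' hQv' hpos hjh)
  · have h1 : v * Q ^ j + u < Q ^ (2 * j) - 1 := by
      have h2 : (v + 1) * Q ^ j ≤ Q ^ j * Q ^ j := Nat.mul_le_mul_right _ hv
      rw [two_mul, pow_add]
      rw [add_mul, one_mul] at h2
      omega
    have h2 := ((leader_mul_pow_modEq_swap hQ u v).symm.trans hmod).eq_of_lt_of_lt h1 (hlt hu' hv')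
    obtain ⟨h3, h4⟩ := eq_of_mul_pow_add_eq (by omega) hv' h2
    omega
  · exfalso
    refine not_leader_mul_pow_modEq (j := 2 * h - j) hu' hv' hu hv hQv (by omega) (by omega) ?_
    have h1 := hmod.symm.mul_right (Q ^ (2 * h - j))
    rw [mul_assoc _ (Q ^ j), ← pow_add, show j + (2 * h - j) = 2 * h by omega] at h1
    refine h1.trans ?_
    simpa using (pow_two_mul_modEq_one (h := h) hQ).mul_left (u * Q ^ h + v)

/-- Remove the powers of `Q` from `i` and split the rest into digits `u`, `v`. If `u ≤ v` this is a
leader. Otherwise swap: `0 < u ≤ a < Q` shows that the new low digit is prime to being a multiple of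
`Q`. -/
theorem exists_leader (hh : 1 ≤ h) {a i : ℕ} (ha : a < Q) (hi : 1 ≤ i) (hi' : i < a * (Q ^ h + 1)) :
    ∃ p ∈ leaderPairs Q h a, ∃ j, (p.1 * Q ^ h + p.2) * Q ^ j ≡ i [MOD Q ^ (2 * h) - 1] := by
  have hQ : 1 < Q := by
    rcases Nat.eq_zero_or_pos a with rfl | h0
    · omega
    · omega
  have hQr : Q ≤ Q ^ h := Nat.le_self_pow (by omega) Q
  obtain ⟨k, m, hm, rfl⟩ := Nat.exists_eq_pow_mul_and_not_dvd (by omega : i ≠ 0) Q (by omega)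
  have hmlt : m < a * (Q ^ h + 1) :=
    (Nat.le_mul_of_pos_left m (Nat.pow_pos (by omega))).trans_lt hi'
  obtain ⟨u, v, hv, rfl⟩ : ∃ u v, v < Q ^ h ∧ m = u * Q ^ h + v :=
    ⟨m / Q ^ h, m % Q ^ h, Nat.mod_lt _ (by omega), (Nat.div_add_mod' m (Q ^ h)).symm⟩
  rw [mul_add, mul_one] at hmlt
  have hua : u ≤ a := by
    by_contra! hc
    have : (a + 1) * Q ^ h ≤ u * Q ^ h := Nat.mul_le_mul_right _ hc
    rw [add_mul, one_mul] at this
    omega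
  have hva : u = a → v < a := by
    rintro rfl
    omega
  have hQv : ¬ Q ∣ v := fun hd => hm (dvd_add ((dvd_pow_self Q (by omega)).mul_left u) hd)
  by_cases huv : u ≤ v
  · have h1 : u < a := by omega
    exact ⟨⟨u, v⟩, mem_leaderPairs.2 ⟨h1, ⟨huv, hv⟩, hQv⟩, k, by rw [mul_comm (Q ^ k)]⟩
  · have h1 : v < a := by omega
    have h2 : v ≤ u := by omega
    have h3 : u < Q ^ h := by omega
    have h4 : ¬ Q ∣ u := fun hd => absurd (Nat.le_of_dvd (by omega) hd) (by omega)
    refine ⟨⟨v, u⟩, mem_leaderPairs.2 ⟨h1, ⟨h2, h3⟩, h4⟩, h + k, ?_⟩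
    rw [mul_comm (Q ^ k), pow_add, ← mul_assoc]
    exact (leader_mul_pow_modEq_swap (by omega) v u).mul_right _

theorem leader_bounds {a : ℕ} {p : Σ _ : ℕ, ℕ} (hp : p ∈ leaderPairs Q h a) :
    1 ≤ p.1 * Q ^ h + p.2 ∧ p.1 * Q ^ h + p.2 < a * (Q ^ h + 1) := by
  obtain ⟨h1, ⟨-, h2⟩, h3⟩ := mem_leaderPairs.1 hp
  have h4 : p.2 ≠ 0 := fun h => h3 (h ▸ dvd_zero Q)
  have h5 : (p.1 + 1) * Q ^ h ≤ a * Q ^ h := Nat.mul_le_mul_right _ h1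
  rw [add_mul, one_mul] at h5
  rw [mul_add, mul_one]
  omega

theorem card_range_filter_not_dvd (hQ : 0 < Q) (k : ℕ) :
    ((Finset.range (Q * k)).filter fun v => ¬ Q ∣ v).card + k = Q * k := by
  have h1 : (Finset.range (Q * k)).filter (fun v => Q ∣ v) =
      (Finset.range k).image fun i => Q * i := by
    ext v
    simp only [Finset.mem_filter, Finset.mem_range, Finset.mem_image]
    constructor
    · rintro ⟨hv, w, rfl⟩
      exact ⟨w, Nat.lt_of_mul_lt_mul_left hv, rfl⟩
    · rintro ⟨w, hw, rfl⟩
      exact ⟨Nat.mul_lt_mul_of_pos_left hw hQ, dvd_mul_right _ _⟩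
  have h2 := Finset.card_filter_add_card_filter_not (s := Finset.range (Q * k)) (fun v => Q ∣ v)
  rw [h1, Finset.card_image_of_injective _ (mul_right_injective₀ hQ.ne'), Finset.card_range,
    Finset.card_range] at h2
  omega

theorem card_range_filter_not_dvd_of_lt {u : ℕ} (hu : u < Q) :
    ((Finset.range u).filter fun v => ¬ Q ∣ v).card = u - 1 := by
  have : (Finset.range u).filter (fun v => ¬ Q ∣ v) = Finset.Ico 1 u := by
    ext v
    simp only [Finset.mem_filter, Finset.mem_range, Finset.mem_Ico]
    constructor
    · rintro ⟨h1, h2⟩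
      exact ⟨Nat.one_le_iff_ne_zero.2 fun h => h2 (h ▸ dvd_zero Q), h1⟩
    · rintro ⟨h1, h2⟩
      exact ⟨h2, fun h => absurd (Nat.le_of_dvd (by omega) h) (by omega)⟩
  rw [this, Nat.card_Ico]

/-- For `u > 0`, the range loses the `u - 1` non-multiples of `Q` below `u`, and the diagonal coset
saves a further `h`. For `u = 0` nothing is lost: the truncated `u - 1` is `0`, and `v = 0` is
excluded as a multiple of `Q`. -/
theorem sum_leaderPairs_aux (hh : 1 ≤ h) {u : ℕ} (hu : u < Q) :
    (∑ v ∈ (Finset.Ico u (Q ^ h)).filter (fun v => ¬ Q ∣ v), if u = v then (h : ℤ) else 2 * h) =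
      2 * h * ((Q : ℤ) ^ h - (Q : ℤ) ^ (h - 1)) - if u = 0 then (0 : ℤ) else h * (2 * u - 1) := by
  have hQr : Q ≤ Q ^ h := Nat.le_self_pow (by omega) Q
  set T := (Finset.Ico u (Q ^ h)).filter (fun v => ¬ Q ∣ v) with hT
  have hcard : ((T.card : ℕ) : ℤ) + (u - 1 : ℕ) = (Q : ℤ) ^ h - (Q : ℤ) ^ (h - 1) := by
    have h1 := card_range_filter_not_dvd (Q := Q) (by omega) (Q ^ (h - 1))
    rw [← pow_succ', Nat.sub_add_cancel hh, Finset.range_eq_Ico,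
      ← Finset.Ico_union_Ico_eq_Ico (Nat.zero_le u) (by omega : u ≤ Q ^ h), Finset.filter_union,
      Finset.card_union_of_disjoint (Finset.disjoint_filter_filter
        (Finset.Ico_disjoint_Ico_consecutive _ _ _)), ← hT, ← Finset.range_eq_Ico,
      card_range_filter_not_dvd_of_lt hu] at h1
    have h2 : ((u - 1 : ℕ) : ℤ) + T.card + (Q : ℤ) ^ (h - 1) = (Q : ℤ) ^ h := by exact_mod_cast h1
    linarith
  have h1 : ∀ v, (if u = v then (h : ℤ) else 2 * h) = 2 * h - if u = v then (h : ℤ) else 0 := by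
    intro v
    split_ifs <;> ring
  simp_rw [h1]
  rw [Finset.sum_sub_distrib, Finset.sum_const, nsmul_eq_mul, Finset.sum_ite_eq, ← hcard]
  rcases Nat.eq_zero_or_pos u with rfl | hpos
  · simp [hT, mul_comm]
  · have : u ∈ T := by
      simp only [hT, Finset.mem_filter, Finset.mem_Ico, le_refl, true_and]
      exact ⟨by omega, fun h => absurd (Nat.le_of_dvd hpos h) (by omega)⟩
    rw [if_pos this, if_neg hpos.ne']
    push_cast [hpos]
    ring

theorem sum_leaderPairs (hh : 1 ≤ h) {a : ℕ} (ha : 1 ≤ a) (haQ : a ≤ Q) :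
    (∑ p ∈ leaderPairs Q h a, if p.1 = p.2 then (h : ℤ) else 2 * h) =
      2 * h * a * ((Q : ℤ) ^ h - (Q : ℤ) ^ (h - 1)) - h * (a - 1) ^ 2 := by
  rw [leaderPairs, Finset.sum_sigma]
  rw [Finset.sum_congr rfl fun u hu => sum_leaderPairs_aux hh
    (lt_of_lt_of_le (Finset.mem_range.1 hu) haQ)]
  clear haQ
  induction a, ha using Nat.le_induction with
  | base => simp
  | succ n hn ih =>
    rw [Finset.sum_range_succ, ih, if_neg (by omega)]
    push_cast
    ring

end Cosets

/-! ### Roots and degree of the generator polynomial -/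

section Degree

variable {F E : Type*} [Field F] [Field E] [Algebra F E] [Finite E]

/-- Roots of a minimal polynomial are Galois conjugates, and Frobenius generates the Galois group.
-/
theorem aeval_minpoly_eq_zero_iff (x y : E) :
    aeval x (minpoly F y) = 0 ↔ ∃ j, x = y ^ (Nat.card F ^ j) := by
  have := Finite.of_injective _ (algebraMap F E).injective
  have := Fintype.ofFinite F
  have := Module.finite_of_finite F (M := E)
  rw [Nat.card_eq_fintype_card]
  have hpow (j : ℕ) (z : E) : (FiniteField.frobeniusAlgEquivOfAlgebraic F E ^ j) z =
      z ^ (Fintype.card F ^ j) := by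
    simp [AlgEquiv.coe_pow, FiniteField.coe_frobeniusAlgEquivOfAlgebraic, pow_iterate]
  rw [← isConjRoot_iff_aeval_eq_zero (Algebra.IsIntegral.isIntegral y), IsConjRoot.comm,
    isConjRoot_iff_exists_algEquiv]
  constructor
  · rintro ⟨σ, hσ⟩
    obtain ⟨j, rfl⟩ := (FiniteField.bijective_frobeniusAlgEquivOfAlgebraic_pow F E).2 σ
    exact ⟨j, by rw [← hσ, hpow]⟩
  · rintro ⟨j, rfl⟩
    exact ⟨FiniteField.frobeniusAlgEquivOfAlgebraic F E ^ j, hpow j y⟩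

theorem natDegree_eq_card_of_dvd [Fintype E] {g : F[X]} (hg : g ∣ X ^ (Nat.card E - 1) - 1)
    (T : Finset E) (hT : ∀ x, x ∈ T ↔ aeval x g = 0) : g.natDegree = T.card := by
  classical
  have hpos := card_sub_one_pos (E := E)
  have hne : (X ^ (Nat.card E - 1) - 1 : F[X]) ≠ 0 := X_pow_sub_C_ne_zero hpos 1
  -- In `E` this number is `-1`, whence separability.
  have hcardF : ((Nat.card E - 1 : ℕ) : F) ≠ 0 := by
    have h1 : ((Nat.card E : ℕ) : E) = 0 := by
      rw [Nat.card_eq_fintype_card]; exact FiniteField.cast_card_eq_zero E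
    intro h
    have h2 := congrArg (algebraMap F E) h
    rw [map_natCast, map_zero, Nat.cast_sub Nat.card_pos, h1] at h2
    simp at h2
  have hsep : g.Separable :=
    (separable_X_pow_sub_C (1 : F) hcardF one_ne_zero).of_dvd (by simpa using hg)
  have hspl : (g.map (algebraMap F E)).Splits := by
    have h1 : (X ^ Nat.card E - X : E[X]) = X * (X ^ (Nat.card E - 1) - 1) := by
      rw [mul_sub, mul_one, ← pow_succ', Nat.sub_add_cancel Nat.card_pos]
    have h2 : (X ^ (Nat.card E - 1) - 1 : E[X]) ≠ 0 := X_pow_sub_C_ne_zero hpos 1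
    refine (Polynomial.splits_X_pow_nat_card_sub_X (K := E)).of_dvd
      (h1 ▸ mul_ne_zero X_ne_zero h2) ?_
    have h3 := Polynomial.map_dvd (algebraMap F E) hg
    simp only [Polynomial.map_sub, Polynomial.map_pow, map_X, Polynomial.map_one] at h3
    exact h1 ▸ h3.mul_left X
  rw [← card_rootSet_eq_natDegree hsep hspl]
  rw [← Set.toFinset_card]
  congr 1
  ext x
  rw [Set.mem_toFinset, hT, mem_rootSet_of_ne (ne_zero_of_dvd_ne_zero hne hg)]

end Degree

/-! ### Dimension of the BCH codes -/

section Dimension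

theorem leader_mul_pow_modEq_mul_pow {Q h a : ℕ} (hh : 1 ≤ h) (ha : a < Q) {p p' : Σ _ : ℕ, ℕ}
    (hp : p ∈ leaderPairs Q h a) (hp' : p' ∈ leaderPairs Q h a) {i j : ℕ} (hij : i ≤ j)
    (hj : j < 2 * h) (hmod : (p.1 * Q ^ h + p.2) * Q ^ j ≡ (p'.1 * Q ^ h + p'.2) * Q ^ i
      [MOD Q ^ (2 * h) - 1]) : p = p' ∧ (j = i ∨ j = i + h ∧ p.1 = p.2) := by
  obtain ⟨u, v⟩ := p
  obtain ⟨u', v'⟩ := p'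
  rw [mem_leaderPairs] at hp hp'
  dsimp only at hp hp' hmod ⊢
  have hcop : (Q ^ (2 * h) - 1).Coprime (Q ^ i) := by
    have h1 : (Q ^ (2 * h) - 1).Coprime (Q ^ (2 * h)) := by
      conv_rhs => rw [← Nat.sub_add_cancel (Nat.pow_pos (n := 2 * h) (by omega : 0 < Q))]
      simp
    exact (Nat.Coprime.coprime_dvd_right (dvd_pow_self Q (by omega)) h1).pow_right i
  obtain ⟨k, rfl⟩ := Nat.exists_eq_add_of_le' hij
  rw [pow_add, ← mul_assoc] at hmod
  obtain ⟨⟨rfl, rfl⟩, h2⟩ := leader_mul_pow_modEq hh (by omega) hp.2.1.1 hp.2.1.2 hp.2.2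
    (by omega) hp'.2.1.1 hp'.2.1.2 hp'.2.2 (by omega) (hmod.cancel_right_of_coprime hcop)
  exact ⟨rfl, by omega⟩

variable {F E : Type*} [Field F] [Field E] [Algebra F E] [Finite E]

omit [Finite E] in
theorem primitive_pow_eq_pow_iff {t : ℕ} (α : Eˣ) (hα : ∀ x : Eˣ, x ∈ Subgroup.zpowers α)
    (ht : t = Nat.card E - 1) (m n : ℕ) : (α : E) ^ m = (α : E) ^ n ↔ m ≡ n [MOD t] := by
  have ho : orderOf α = t := by
    rw [orderOf_eq_card_of_forall_mem_zpowers hα, Nat.card_units, ht]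
  rw [← ho, ← pow_eq_pow_iff_modEq, Units.ext_iff, Units.val_pow_eq_pow_val,
    Units.val_pow_eq_pow_val]

theorem natDegree_bchGenerator {Q h a t : ℕ} (hh : 1 ≤ h) (ha : 1 ≤ a) (haQ : a < Q)
    (hF : Nat.card F = Q) (hE : Nat.card E = Q ^ (2 * h)) (ht : t = Nat.card E - 1) (α : Eˣ)
    (hα : ∀ x : Eˣ, x ∈ Subgroup.zpowers α) :
    ((bchGenerator F α t (a * (Q ^ h + 1)) 1).natDegree : ℤ) =
      2 * h * a * ((Q : ℤ) ^ h - (Q : ℤ) ^ (h - 1)) - h * (a - 1) ^ 2 := by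
  classical
  have := Fintype.ofFinite E
  have := Finite.of_injective _ (algebraMap F E).injective
  have := Module.finite_of_finite F (M := E)
  have hpow := primitive_pow_eq_pow_iff α hα ht
  have ht' : t = Q ^ (2 * h) - 1 := by rw [ht, hE]
  let O (p : Σ _ : ℕ, ℕ) : Finset E :=
    (Finset.range (2 * h)).image fun j => (α : E) ^ ((p.1 * Q ^ h + p.2) * Q ^ j)
  have hmem (x : E) : x ∈ (leaderPairs Q h a).biUnion O ↔
      aeval x (bchGenerator F α t (a * (Q ^ h + 1)) 1) = 0 := by
    rw [bchGenerator_eq α ht, aeval_lcm_minpoly_eq_zero_iff]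
    simp only [aeval_minpoly_eq_zero_iff, Finset.mem_biUnion, O, Finset.mem_image,
      Finset.mem_range, ← pow_mul, hF]
    constructor
    · rintro ⟨p, hp, j, -, rfl⟩
      have := leader_bounds hp
      exact ⟨p.1 * Q ^ h + p.2 - 1, by omega, j, by rw [Nat.add_sub_cancel' this.1]⟩
    · rintro ⟨i, hi, k, rfl⟩
      obtain ⟨p, hp, j, hj⟩ := exists_leader hh haQ (i := 1 + i) (by omega) (by omega)
      refine ⟨p, hp, (j + k) % (2 * h), Nat.mod_lt _ (by omega), ?_⟩
      rw [hpow, ht']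
      have h1 : Q ^ (j + k) ≡ Q ^ ((j + k) % (2 * h)) [MOD Q ^ (2 * h) - 1] := by
        conv_lhs => rw [← Nat.div_add_mod (j + k) (2 * h), pow_add, pow_mul]
        simpa using ((pow_two_mul_modEq_one (by omega)).pow ((j + k) / (2 * h))).mul_right
          (Q ^ ((j + k) % (2 * h)))
      refine (h1.symm.mul_left _).trans ?_
      rw [pow_add, ← mul_assoc]
      exact hj.mul_right _
  have hdisj : ((leaderPairs Q h a : Set (Σ _ : ℕ, ℕ))).PairwiseDisjoint O := by
    intro p hp p' hp' hne
    rw [Function.onFun, Finset.disjoint_left]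
    simp only [O, Finset.mem_image, Finset.mem_range, not_exists, not_and]
    rintro _ ⟨i, hi, rfl⟩ j hj heq
    rw [hpow, ht'] at heq
    rcases le_total i j with hij | hij
    · exact hne (leader_mul_pow_modEq_mul_pow hh haQ hp' hp hij hj heq).1.symm
    · exact hne (leader_mul_pow_modEq_mul_pow hh haQ hp hp' hij hi heq.symm).1
  have hcard (p : Σ _ : ℕ, ℕ) (hp : p ∈ leaderPairs Q h a) :
      ((O p).card : ℤ) = if p.1 = p.2 then (h : ℤ) else 2 * h := by
    have hinj {n : ℕ} (hn : n ≤ 2 * h) (hn' : p.1 = p.2 → n ≤ h) :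
        Set.InjOn (fun j => (α : E) ^ ((p.1 * Q ^ h + p.2) * Q ^ j)) (Finset.range n : Set ℕ) := by
      intro i hi j hj heq
      rw [Finset.coe_range, Set.mem_Iio] at hi hj
      rw [hpow, ht'] at heq
      rcases le_total i j with hij | hij
      · have := (leader_mul_pow_modEq_mul_pow hh haQ hp hp hij (by omega) heq.symm).2
        omega
      · have := (leader_mul_pow_modEq_mul_pow hh haQ hp hp hij (by omega) heq).2
        omega
    split_ifs with heq
    · have hO : O p = (Finset.range h).image fun j => (α : E) ^ ((p.1 * Q ^ h + p.2) * Q ^ j) := by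
        refine Finset.Subset.antisymm ?_ (Finset.image_subset_image ?_)
        · intro x hx
          obtain ⟨j, hj, rfl⟩ := Finset.mem_image.1 hx
          rw [Finset.mem_range] at hj
          rcases lt_or_ge j h with hjh | hjh
          · exact Finset.mem_image_of_mem _ (Finset.mem_range.2 hjh)
          · refine Finset.mem_image.2 ⟨j - h, Finset.mem_range.2 (by omega), ?_⟩
            rw [hpow, ht']
            have h1 := (leader_mul_pow_modEq_swap (Q := Q) (h := h) (by omega) p.1 p.2).mul_right
              (Q ^ (j - h))
            rw [mul_assoc _ (Q ^ h) (Q ^ (j - h)), ← pow_add, Nat.add_sub_cancel' hjh] at h1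
            rw [heq] at h1 ⊢
            exact h1.symm
        · exact Finset.range_subset_range.2 (by omega)
      rw [hO, Finset.card_image_of_injOn (hinj (by omega) fun _ => le_rfl), Finset.card_range]
    · rw [Finset.card_image_of_injOn (hinj le_rfl fun h => absurd h heq), Finset.card_range]
      push_cast
      rfl
  rw [natDegree_eq_card_of_dvd (ht ▸ bchGenerator_dvd α ht _) _ hmem, Finset.card_biUnion hdisj,
    Nat.cast_sum, Finset.sum_congr rfl hcard, sum_leaderPairs hh ha haQ.le]

theorem finrank_bchCode {Q h a t : ℕ} (hh : 1 ≤ h) (ha : 1 ≤ a) (haQ : a < Q)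
    (hF : Nat.card F = Q) (hE : Nat.card E = Q ^ (2 * h)) (ht : t = Nat.card E - 1) (α : Eˣ)
    (hα : ∀ x : Eˣ, x ∈ Subgroup.zpowers α) :
    (Module.finrank F (bchCode F α t (a * (Q ^ h + 1)) 1) : ℤ) =
      t - (2 * h * a * ((Q : ℤ) ^ h - (Q : ℤ) ^ (h - 1)) - h * (a - 1) ^ 2) := by
  rw [← natDegree_bchGenerator (F := F) hh ha haQ hF hE ht α hα, eq_sub_iff_add_eq]
  exact_mod_cast finrank_cyclicCode_add_natDegree (ht ▸ card_sub_one_pos) (bchGenerator_dvd α ht _)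

end Dimension

/-! ### A BCH codeword of weight equal to the designed distance -/

section MinimumWeight

variable {F E : Type*} [Field F] [Field E] [Algebra F E] [Finite E] [DecidableEq F]

/-- For `a < Q`, the BCH code of designed distance `a * (Q ^ h + 1)` has a nonzero word of weight
at most its designed distance: it is supported on `a` fibres of the norm to the subfield of
order `Q ^ h`. -/
theorem exists_mem_bchCode_card_support_le {Q h a t : ℕ} (ha : 1 ≤ a) (haQ : a < Q)
    (hF : Nat.card F = Q) (hE : Nat.card E = Q ^ (2 * h)) (ht : t = Nat.card E - 1) (α : Eˣ)
    (hα : ∀ x : Eˣ, x ∈ Subgroup.zpowers α) :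
    ∃ c ∈ bchCode F α t (a * (Q ^ h + 1)) 1, c ≠ 0 ∧
      (Finset.univ.filter fun j => c j ≠ 0).card ≤ a * (Q ^ h + 1) := by
  classical
  have := Finite.of_injective _ (algebraMap F E).injective
  have := Fintype.ofFinite F
  have := Fintype.ofFinite E
  have hpow := primitive_pow_eq_pow_iff α hα ht
  have htpos : 0 < t := ht ▸ card_sub_one_pos
  have ht' : t = (Q ^ h + 1) * (Q ^ h - 1) := by
    rw [ht, hE, mul_comm 2, pow_mul, ← Nat.sq_sub_sq, one_pow]
  let N (j : Fin t) : E := ((α : E) ^ (j : ℕ)) ^ (Q ^ h + 1)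
  obtain ⟨A, hA, hAcard⟩ : ∃ A : Finset F, (0 : F) ∉ A ∧ A.card = a := by
    obtain ⟨A, hA, hAcard⟩ := Finset.exists_subset_card_eq
      (s := Finset.univ.erase (0 : F)) (n := a) (by
        rw [Finset.card_erase_of_mem (Finset.mem_univ _), Finset.card_univ,
          ← Nat.card_eq_fintype_card, hF]
        omega)
    exact ⟨A, fun h => Finset.notMem_erase _ _ (hA h), hAcard⟩
  let fib (b : F) : Finset (Fin t) := Finset.univ.filter fun j => N j = algebraMap F E b
  have hfib (b : F) : (fib b).card ≤ Q ^ h + 1 := by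
    have h1 : (fib b).image (fun j : Fin t => (α : E) ^ (j : ℕ)) ⊆
        (nthRoots (Q ^ h + 1) (algebraMap F E b)).toFinset := by
      intro x hx
      obtain ⟨j, hj, rfl⟩ := Finset.mem_image.1 hx
      rw [Multiset.mem_toFinset, mem_nthRoots (by omega)]
      exact (Finset.mem_filter.1 hj).2
    rw [← Finset.card_image_of_injective _ (injective_pow_primitive α hα ht)]
    exact (Finset.card_le_card h1).trans
      ((Multiset.toFinset_card_le _).trans (card_nthRoots _ _))
  -- Write `b = α ^ m`. Since `b ^ (Q ^ h - 1) = 1`, the exponent `m` is a multiple of `Q ^ h + 1`,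
  -- so `b` is a norm.
  have hfib_ne (b : F) (hb : b ≠ 0) : (fib b).Nonempty := by
    have hb' : algebraMap F E b ≠ 0 := (_root_.map_ne_zero _).2 hb
    obtain ⟨m, hm⟩ := (mem_powers_iff_mem_zpowers.2 (hα (Units.mk0 _ hb')))
    replace hm : (α : E) ^ m = algebraMap F E b := by
      rw [← Units.val_pow_eq_pow_val]
      exact congrArg Units.val hm
    have h1 : (α : E) ^ (m * (Q ^ h - 1)) = (α : E) ^ 0 := by
      have h2 : b ^ (Q ^ h) = b := by
        rw [← hF, Nat.card_eq_fintype_card]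
        exact FiniteField.pow_card_pow h b
      have h3 : b ^ (Q ^ h - 1) = 1 := by
        apply mul_right_cancel₀ hb
        rw [← pow_succ, Nat.sub_add_cancel (Nat.pow_pos (by omega)), h2, one_mul]
      rw [pow_mul, hm, ← map_pow, h3, map_one, pow_zero]
    rw [hpow, Nat.modEq_zero_iff_dvd, ht'] at h1
    have h2 : 0 < Q ^ h - 1 := Nat.pos_of_ne_zero fun h0 => by simp [ht', h0] at htpos
    obtain ⟨k, rfl⟩ := Nat.dvd_of_mul_dvd_mul_right h2 h1
    refine ⟨⟨k % t, Nat.mod_lt _ htpos⟩, Finset.mem_filter.2 ⟨Finset.mem_univ _, ?_⟩⟩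
    change ((α : E) ^ (k % t)) ^ (Q ^ h + 1) = _
    rw [(hpow _ _).2 (Nat.mod_modEq k t), ← hm, ← pow_mul, mul_comm]
  -- The parity checks at `(Q ^ h + 1) * k`, `1 ≤ k < a`, are `a - 1` linear conditions on `a`
  -- values. Keeping the fibre sizes as coefficients avoids computing them exactly.
  let Φ : (A → F) →ₗ[F] (Fin (a - 1) → F) :=
    LinearMap.pi fun k => ∑ b : A, (((b : F) ^ (k + 1 : ℕ)) * ((fib b).card : F)) •
      LinearMap.proj b
  have hker : LinearMap.ker Φ ≠ ⊥ := by
    apply LinearMap.ker_ne_bot_of_finrank_lt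
    rw [Module.finrank_fin_fun, Module.finrank_fintype_fun_eq_card, Fintype.card_coe, hAcard]
    omega
  obtain ⟨d, hd, hd0⟩ := Submodule.exists_mem_ne_zero_of_ne_bot hker
  have hdsum (k : ℕ) (hk : 1 ≤ k) (hka : k < a) :
      ∑ b : A, d b * (b : F) ^ k * ((fib b).card : F) = 0 := by
    have h1 := congrFun (LinearMap.mem_ker.1 hd) ⟨k - 1, by omega⟩
    simp only [Φ, LinearMap.pi_apply, LinearMap.sum_apply, LinearMap.smul_apply,
      LinearMap.proj_apply, smul_eq_mul, Nat.sub_add_cancel hk, Pi.zero_apply] at h1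
    rw [← h1]
    exact Finset.sum_congr rfl fun b _ => by ring
  let c (j : Fin t) : F := ∑ b : A, if N j = algebraMap F E b then d b else 0
  have hc_eq {j : Fin t} {b : A} (hj : N j = algebraMap F E b) : c j = d b := by
    have h1 (b' : A) : N j = algebraMap F E b' ↔ b = b' := by
      rw [hj, (algebraMap F E).injective.eq_iff, Subtype.ext_iff]
    simp [c, h1]
  have hc_ne {j : Fin t} (hj : c j ≠ 0) : ∃ b ∈ A, j ∈ fib b := by
    obtain ⟨b, -, hb⟩ := Finset.exists_ne_zero_of_sum_ne_zero hj
    exact ⟨b, b.2, Finset.mem_filter.2 ⟨Finset.mem_univ _, (ite_ne_right_iff.1 hb).1⟩⟩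
  refine ⟨c, (mem_bchCode_iff α ht _ c).2 ?_, ?_, ?_⟩
  · intro i hi hi'
    by_cases hdvd : Q ^ h + 1 ∣ i
    · obtain ⟨k, rfl⟩ := hdvd
      have hk : 1 ≤ k := Nat.one_le_iff_ne_zero.2 fun h0 => by simp [h0] at hi
      have hka : k < a := by
        rw [mul_comm a] at hi'
        exact Nat.lt_of_mul_lt_mul_left hi'
      have h1 (j : Fin t) : algebraMap F E (c j) * ((α : E) ^ (j : ℕ)) ^ ((Q ^ h + 1) * k) =
          ∑ b : A, if j ∈ fib b then algebraMap F E (d b * (b : F) ^ k) else 0 := by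
        rw [pow_mul]
        change algebraMap F E (c j) * N j ^ k = _
        rw [map_sum, Finset.sum_mul]
        refine Finset.sum_congr rfl fun b _ => ?_
        by_cases hb : N j = algebraMap F E b
        · simp [fib, hb]
        · simp [fib, hb]
      simp_rw [h1]
      rw [Finset.sum_comm]
      simp_rw [Finset.sum_ite_mem, Finset.univ_inter, Finset.sum_const, nsmul_eq_mul]
      rw [← map_zero (algebraMap F E), ← hdsum k hk hka, map_sum]
      exact Finset.sum_congr rfl fun b _ => by
        rw [map_mul _ _ ((fib b).card : F), map_natCast, mul_comm]
    -- Multiplying `x` by `ζ = α ^ (Q ^ h - 1)` preserves the norm and scales the sum by `ζ ^ i ≠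
    -- 1`, so the sum is zero.
    · let f (x : Eˣ) : E := algebraMap F E
        (∑ b : A, if (x : E) ^ (Q ^ h + 1) = algebraMap F E b then d b else 0) * (x : E) ^ i
      have hbij : Function.Bijective fun j : Fin t => α ^ (j : ℕ) := by
        rw [Fintype.bijective_iff_injective_and_card]
        refine ⟨fun j j' hj => injective_pow_primitive α hα ht (by
          simpa using congrArg Units.val hj), ?_⟩
        rw [Fintype.card_fin, ht, Fintype.card_units, Nat.card_eq_fintype_card]
      have hsum : ∑ j, algebraMap F E (c j) * ((α : E) ^ (j : ℕ)) ^ i = ∑ x, f x :=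
        Fintype.sum_bijective _ hbij _ _ fun j => by simp [f, c, N]
      have hζ : ((α : E) ^ (Q ^ h - 1)) ^ (Q ^ h + 1) = 1 := by
        rw [← pow_mul, mul_comm, ← ht', ht, units_pow_card_sub_one]
      have hζi : ((α : E) ^ (Q ^ h - 1)) ^ i ≠ 1 := by
        rw [← pow_mul, ← pow_zero (α : E), Ne, hpow, Nat.modEq_zero_iff_dvd, ht', mul_comm]
        have h2 : 0 < Q ^ h - 1 := Nat.pos_of_ne_zero fun h0 => by simp [ht', h0] at htpos
        exact fun h3 => hdvd (Nat.dvd_of_mul_dvd_mul_left h2 h3)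
      have hshift : ∑ x, f x = ((α : E) ^ (Q ^ h - 1)) ^ i * ∑ x, f x := by
        refine (Equiv.sum_comp (Equiv.mulLeft (α ^ (Q ^ h - 1))) f).symm.trans ?_
        rw [Finset.mul_sum]
        refine Finset.sum_congr rfl fun x _ => ?_
        simp only [f, Equiv.coe_mulLeft, Units.val_mul, Units.val_pow_eq_pow_val, mul_pow, hζ,
          one_mul]
        ring
      rw [hsum]
      by_contra h0
      exact hζi (mul_right_cancel₀ h0 (by rw [one_mul]; exact hshift.symm))
  · obtain ⟨b, hb⟩ := Function.ne_iff.1 hd0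
    obtain ⟨j, hj⟩ := hfib_ne b fun h => hA (h ▸ b.2)
    intro h0
    exact hb ((hc_eq (Finset.mem_filter.1 hj).2).symm.trans (congrFun h0 j))
  · calc (Finset.univ.filter fun j => c j ≠ 0).card ≤ (A.biUnion fib).card :=
          Finset.card_le_card fun j hj => Finset.mem_biUnion.2 (hc_ne (Finset.mem_filter.1 hj).2)
      _ ≤ A.card * (Q ^ h + 1) := Finset.card_biUnion_le_card_mul _ _ _ fun b _ => hfib b
      _ = _ := by rw [hAcard]

end MinimumWeight

/-! ### Sum-rank codes from pairs of linear codes -/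

section SumRank

variable {K L : Type*} [Field K] [Fintype K] [Field L] [Algebra K L]

/-- A polynomial of degree at most `q` that vanishes on all `q ^ 2` elements of `L` is zero. -/
theorem qPolyMap_eq_zero (B : Module.Basis (Fin 2) K L) {a : Fin 2 → L}
    (h : qPolyMap K a = 0) : a = 0 := by
  have := Module.Finite.of_basis B
  have := Module.finite_of_finite K (M := L)
  have := Fintype.ofFinite L
  have hcard : Fintype.card L = Fintype.card K ^ 2 := by
    rw [Module.card_fintype B, Fintype.card_fin]
  have hq : 1 < Fintype.card K := Fintype.one_lt_card
  set q := Fintype.card K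
  let P : L[X] := C (a 0) * X ^ 1 + C (a 1) * X ^ q
  have hP : P = 0 := by
    refine eq_zero_of_natDegree_lt_card_of_eval_eq_zero P Function.injective_id (fun x => ?_) ?_
    · have := LinearMap.congr_fun h x
      simpa [P, qPolyMap, Fin.sum_univ_two] using this
    · refine lt_of_le_of_lt (b := q) ?_ (by rw [hcard]; nlinarith)
      refine natDegree_add_le_of_degree_le ((natDegree_C_mul_X_pow_le _ _).trans hq.le)
        (natDegree_C_mul_X_pow_le _ _)
  funext i
  fin_cases i
  · have := congrArg (fun p => coeff p 1) hP
    simpa [P, coeff_X_pow, hq.ne] using this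
  · have := congrArg (fun p => coeff p q) hP
    simpa [P, coeff_X, hq.ne] using this

theorem srWord_apply_eq_zero (B : Module.Basis (Fin 2) K L) {t : ℕ} {c : Fin 2 → Fin t → L}
    {j : Fin t} (h : srWord B c j = 0) (i : Fin 2) : c i j = 0 :=
  congrFun (qPolyMap_eq_zero B ((LinearMap.toMatrix B B).map_eq_zero_iff.1 h)) i

/-- The encoding map of a sum-rank code, as a linear map. -/
noncomputable def srEncode {m t : ℕ} (B : Module.Basis (Fin m) K L)
    (D : Fin m → Submodule L (Fin t → L)) :
    ((i : Fin m) → D i) →ₗ[K] (Fin t → Matrix (Fin m) (Fin m) K) where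
  toFun c := srWord B fun i => c i
  map_add' c d := by
    funext j
    refine (congrArg (LinearMap.toMatrix B B) ?_).trans (map_add (LinearMap.toMatrix B B) _ _)
    ext x
    simp [qPolyMap, add_mul, Finset.sum_add_distrib]
  map_smul' a c := by
    funext j
    refine (congrArg (LinearMap.toMatrix B B) ?_).trans (map_smul (LinearMap.toMatrix B B) a _)
    ext x
    simp [qPolyMap, Finset.smul_sum]

theorem range_srEncode {m t : ℕ} (B : Module.Basis (Fin m) K L)
    (D : Fin m → Submodule L (Fin t → L)) : LinearMap.range (srEncode B D) = srCode B D := by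
  ext x
  constructor
  · rintro ⟨c, rfl⟩
    exact ⟨fun i => c i, fun i => (c i).2, rfl⟩
  · rintro ⟨c, hc, rfl⟩
    exact ⟨fun i => ⟨c i, hc i⟩, rfl⟩

theorem finrank_srCode (B : Module.Basis (Fin 2) K L) {t : ℕ}
    (D : Fin 2 → Submodule L (Fin t → L)) :
    Module.finrank K (srCode B D) = 2 * (Module.finrank L (D 0) + Module.finrank L (D 1)) := by
  have := Module.Finite.of_basis B
  have hinj : Function.Injective (srEncode B D) := by
    rw [injective_iff_map_eq_zero]
    intro c hc
    funext i
    ext j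
    exact srWord_apply_eq_zero B (congrFun hc j) i
  have (i : Fin 2) : Module.Finite K (D i) := Module.Finite.trans L (D i)
  rw [← range_srEncode, LinearMap.finrank_range_of_inj hinj, Module.finrank_pi_fintype,
    Fin.sum_univ_two, ← Module.finrank_mul_finrank K L (D 0), ← Module.finrank_mul_finrank K L (D 1),
    Module.finrank_eq_card_basis B, Fintype.card_fin, mul_add]

theorem srCode_isCyclic {m t : ℕ} (B : Module.Basis (Fin m) K L)
    (D : Fin m → Submodule L (Fin t → L))
    (hD : ∀ i, ∀ c ∈ D i, (fun j => c ((finRotate t).symm j)) ∈ D i) :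
    IsCyclicSumRank (srCode B D : Set (Fin t → Matrix (Fin m) (Fin m) K)) := by
  rintro _ ⟨c, hc, rfl⟩
  exact ⟨fun i j => c i ((finRotate t).symm j), fun i => hD i _ (hc i), rfl⟩

theorem rank_srWord_of_right_eq_zero (B : Module.Basis (Fin 2) K L) {t : ℕ}
    {c : Fin 2 → Fin t → L} {j : Fin t} (h0 : c 0 j ≠ 0) (h1 : c 1 j = 0) :
    (srWord B c j).rank = 2 := by
  have hinj : Function.Injective (qPolyMap K fun i => c i j) := by
    rw [injective_iff_map_eq_zero]
    intro x hx
    simpa [qPolyMap, Fin.sum_univ_two, h1, h0] using hx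
  have hrank := (srWord B c j).rank_eq_finrank_range_toLin B B
  rw [srWord, Matrix.toLin_toMatrix, LinearMap.finrank_range_of_inj hinj,
    Module.finrank_eq_card_basis B, Fintype.card_fin] at hrank
  exact hrank

theorem two_mul_card_le_sumRankWeight [DecidableEq L] (B : Module.Basis (Fin 2) K L) {t : ℕ}
    {c : Fin 2 → Fin t → L} (h1 : c 1 = 0) :
    2 * (Finset.univ.filter fun j => c 0 j ≠ 0).card ≤ sumRankWeight (srWord B c) := by
  rw [sumRankWeight, mul_comm, ← smul_eq_mul, ← Finset.sum_const, Finset.sum_filter]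
  refine Finset.sum_le_sum fun j _ => ?_
  split_ifs with h
  · exact (rank_srWord_of_right_eq_zero B h (congrFun h1 j)).ge
  · exact Nat.zero_le _

theorem card_le_sumRankWeight [DecidableEq L] (B : Module.Basis (Fin 2) K L) {t : ℕ}
    (c : Fin 2 → Fin t → L) :
    (Finset.univ.filter fun j => c 1 j ≠ 0).card ≤ sumRankWeight (srWord B c) := by
  have := Module.Finite.of_basis B
  rw [sumRankWeight, Finset.card_filter]
  refine Finset.sum_le_sum fun j _ => ?_
  split_ifs with h
  · rw [Nat.one_le_iff_ne_zero]
    intro h0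
    rw [(srWord B c j).rank_eq_finrank_range_toLin B B, Submodule.finrank_eq_zero,
      LinearMap.range_eq_bot, LinearEquiv.map_eq_zero_iff] at h0
    exact h (srWord_apply_eq_zero B h0 1)
  · exact Nat.zero_le _

theorem sumRankWeight_le_two_mul_card [DecidableEq L] (B : Module.Basis (Fin 2) K L) {t : ℕ}
    {c : Fin 2 → Fin t → L} (h1 : c 1 = 0) :
    sumRankWeight (srWord B c) ≤ 2 * (Finset.univ.filter fun j => c 0 j ≠ 0).card := by
  rw [sumRankWeight, mul_comm, ← smul_eq_mul, ← Finset.sum_const, Finset.sum_filter]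
  refine Finset.sum_le_sum fun j _ => ?_
  split_ifs with h
  · exact Matrix.rank_le_width _
  · rw [not_not] at h
    have h2 : srWord B c j = 0 := by
      refine (LinearMap.toMatrix B B).map_eq_zero_iff.2 ?_
      ext x
      simp [qPolyMap, Fin.sum_univ_two, h, congrFun h1 j]
    rw [h2, Matrix.rank_zero]

/-- If all nonzero words of `D 0` and `D 1` have weight at least `d` and `2 * d`, and `D 0` has a
nonzero word of weight at most `d`, then the sum-rank code has minimum distance `2 * d`. -/
theorem isMinSumRankDist_srCode [DecidableEq L] (B : Module.Basis (Fin 2) K L) {t d : ℕ}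
    (D : Fin 2 → Submodule L (Fin t → L))
    (hD0 : ∀ c ∈ D 0, c ≠ 0 → d ≤ (Finset.univ.filter fun j => c j ≠ 0).card)
    (hD1 : ∀ c ∈ D 1, c ≠ 0 → 2 * d ≤ (Finset.univ.filter fun j => c j ≠ 0).card)
    (hex : ∃ c ∈ D 0, c ≠ 0 ∧ (Finset.univ.filter fun j => c j ≠ 0).card ≤ d) :
    IsMinSumRankDist (srCode B D : Set (Fin t → Matrix (Fin 2) (Fin 2) K)) (2 * d) := by
  have hlow : ∀ x ∈ srCode B D, x ≠ 0 → 2 * d ≤ sumRankWeight x := by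
    rintro _ ⟨c, hc, rfl⟩ hne
    by_cases h1 : c 1 = 0
    · refine le_trans ?_ (two_mul_card_le_sumRankWeight B h1)
      refine Nat.mul_le_mul_left 2 (hD0 _ (hc 0) fun h0 => hne ?_)
      have : c = fun i => ((0 : (i : Fin 2) → D i) i : Fin t → L) := by
        funext i
        fin_cases i
        · exact h0
        · exact h1
      rw [this]
      exact map_zero (srEncode B D)
    · exact (hD1 _ (hc 1) h1).trans (card_le_sumRankWeight B c)
  constructor
  · obtain ⟨c, hc, hc0, hcd⟩ := hex
    have hmem : srWord B ![c, 0] ∈ srCode B D := by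
      refine ⟨![c, 0], fun i => ?_, rfl⟩
      fin_cases i
      · exact hc
      · exact (D 1).zero_mem
    have hne : srWord B ![c, 0] ≠ 0 := fun h =>
      hc0 (funext fun j => srWord_apply_eq_zero B (congrFun h j) 0)
    refine ⟨_, hmem, 0, (srCode B D).zero_mem, hne, ?_⟩
    rw [sumRankDist, sub_zero]
    exact le_antisymm ((sumRankWeight_le_two_mul_card B rfl).trans (Nat.mul_le_mul_left 2 hcd))
      (hlow _ hmem hne)
  · rintro e ⟨x, hx, y, hy, hne, rfl⟩
    exact hlow _ ((srCode B D).sub_mem hx hy) (sub_ne_zero.2 hne)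

end SumRank

end SumRankCodes

/-! ### Assembly with `Q = q ^ 2` -/

theorem proposition4p1
    {K L E : Type*} [Field K] [Fintype K] [Field L] [Algebra K L] [Field E] [Algebra L E]
    (q h ℓ t η : ℕ) (hq : Fintype.card K = q) (hh : 1 ≤ h) (hℓ : ℓ = 2 * h)
    (ht : t = q ^ (2 * ℓ) - 1) (hη : 1 ≤ η) (hη2 : 2 * η ≤ q - 1)
    (B : Module.Basis (Fin 2) K L)
    (hE : Nat.card E = q ^ (2 * ℓ))
    (α : Eˣ) (hα : ∀ x : Eˣ, x ∈ Subgroup.zpowers α)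
    (S : Submodule K (Fin t → Matrix (Fin 2) (Fin 2) K))
    (hS : S = SumRankCodes.srCode B
      ![SumRankCodes.bchCode L α t (η * (q ^ (2 * h) + 1)) 1,
        SumRankCodes.bchCode L α t (2 * η * (q ^ (2 * h) + 1)) 1]) :
    SumRankCodes.IsCyclicSumRank (S : Set (Fin t → Matrix (Fin 2) (Fin 2) K)) ∧
    (Module.finrank K S : ℚ) =
      2 * (2 * (t : ℚ) - (ℓ : ℚ) / 2 *
        (6 * (η : ℚ) * ((q : ℚ) ^ (2 * h) - (q : ℚ) ^ (2 * (h - 1)))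
          - ((η : ℚ) - 1) ^ 2 - (2 * (η : ℚ) - 1) ^ 2)) ∧
    SumRankCodes.IsMinSumRankDist (S : Set (Fin t → Matrix (Fin 2) (Fin 2) K))
      (2 * η * (q ^ (2 * h) + 1)) := by
  classical
  subst hS hℓ
  -- With `2 * η ≤ q - 1`, this puts both `η` and `2 * η` below `Q`.
  have hqq : q ≤ q ^ 2 := Nat.le_self_pow two_ne_zero q
  have : Finite E := (Nat.card_pos_iff.1 (hE ▸ Nat.pow_pos (by omega))).2
  have htE : t = Nat.card E - 1 := by rw [ht, hE]
  have hL : Nat.card L = q ^ 2 := by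
    have := Module.Finite.of_basis B
    have := Module.finite_of_finite K (M := L)
    have := Fintype.ofFinite L
    rw [Nat.card_eq_fintype_card, Module.card_fintype B, Fintype.card_fin, hq]
  have hE' : Nat.card E = (q ^ 2) ^ (2 * h) := by rw [hE, pow_mul]
  rw [pow_mul q 2 h]
  refine ⟨?_, ?_, ?_⟩
  · refine SumRankCodes.srCode_isCyclic B _ fun i c hc => ?_
    fin_cases i
    · exact SumRankCodes.bchCode_rotate α htE _ hc
    · exact SumRankCodes.bchCode_rotate α htE _ hc
  · have h0 := SumRankCodes.finrank_bchCode (F := L) hh hη (by omega) hL hE' htE α hα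
    have h1 := SumRankCodes.finrank_bchCode (F := L) (a := 2 * η) hh (by omega) (by omega) hL hE'
      htE α hα
    replace h0 := congrArg (Int.cast : ℤ → ℚ) h0
    replace h1 := congrArg (Int.cast : ℤ → ℚ) h1
    rw [SumRankCodes.finrank_srCode]
    change ((2 * (Module.finrank L (SumRankCodes.bchCode L α t (η * ((q ^ 2) ^ h + 1)) 1) +
      Module.finrank L (SumRankCodes.bchCode L α t (2 * η * ((q ^ 2) ^ h + 1)) 1)) : ℕ) : ℚ) = _
    push_cast at h0 h1 ⊢
    rw [h0, h1, pow_mul, pow_mul]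
    ring
  · rw [mul_assoc 2 η]
    refine SumRankCodes.isMinSumRankDist_srCode B _ ?_ ?_ ?_
    · exact fun c hc hc0 => SumRankCodes.le_card_support_of_mem_bchCode α hα htE _ hc hc0
    · rw [← mul_assoc]
      exact fun c hc hc0 => SumRankCodes.le_card_support_of_mem_bchCode α hα htE _ hc hc0
    · exact SumRankCodes.exists_mem_bchCode_card_support_le hη (by omega) hL hE' htE α hα
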